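/- Let $\mathbb{Q}$ denote the real quaternions, and let $n_1,n_2,m\ge 1$. For a tensor $\mathcal{T}\in\mathbb{Q}^{n_1\times n_2\times m}$ write $\mathbf{T}_t=\mathcal{T}(:,:,t)\in\mathbb{Q}^{n_1\times n_2}$ ($t=1,\dots,m$) for its frontal slices; let $\mathrm{unfold}(\mathcal{T})\in\mathbb{Q}^{n_1m\times n_2}$ be the block column $(\mathbf{T}_1;\mathbf{T}_2;\dots;\mathbf{T}_m)$, $\mathrm{fold}$ the inverse operation, and $\mathrm{bcirc}(\mathcal{T})\in\mathbb{Q}^{n_1m\times n_2m}$ the block circulant matrix with first block column $(\mathbf{T}_1;\dots;\mathbf{T}_m)$, i.e. with $(s,t)$ block $\mathbf{T}_{((s-t)\bmod m)+1}$. The t-product of $\mathcal{T}\in\mathbb{Q}^{n_1\times n_2\times m}$ and $\mathcal{B}\in\mathbb{Q}^{n_2\times n_3\times m}$ is $\mathcal{T}\star\mathcal{B}=\mathrm{fold}(\mathrm{bcirc}(\mathcal{T})\,\mathrm{unfold}(\mathcal{B}))\in\mathbb{Q}^{n_1\times n_3\times m}$. The conjugate transpose $\mathcal{T}^*\in\mathbb{Q}^{n_2\times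 n_1\times m}$ is obtained by conjugate transposing every frontal slice and then reversing the order of the slices $2,\dots,m$. The identity tensor $\mathcal{I}\in\mathbb{Q}^{n\times n\times m}$ has first frontal slice the $n\times n$ identity matrix and all other frontal slices zero. A tensor $\mathcal{W}\in\mathbb{Q}^{n\times n\times m}$ is unitary if $\mathcal{W}^*\star\mathcal{W}=\mathcal{W}\star\mathcal{W}^*=\mathcal{I}$, and a tensor is diagonal if each of its frontal slices is a (rectangular) diagonal matrix. **Theorem (Quaternion tensor SVD).** For every quaternion tensor $\mathcal{T}\in\mathbb{Q}^{n_1\times n_2\times m}$ there exist unitary quaternion tensors $\mathcal{U}\in\mathbb{Q}^{n_1\times n_1\times m}$ and $\mathcal{V}\in\mathbb{Q}^{n_2\times n_2\times m}$ and a diagonal tensor $\mathcal{S}\in\mathbb{Q}^{n_1\times n_2\times m}$ such that $$\mathcal{T}=\mathcal{U}\star\mathcal{S}\star\mathcal{V}^*.$$ -/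

import Mathlib

/-- Third-order quaternion tensors of size `n₁ × n₂ × m`, with entries `T i j t`.  All indices are
zero-based, and the tube index `t : Fin m` is read cyclically (arithmetic modulo `m`). -/
abbrev QTensor (n₁ n₂ m : ℕ) : Type := Fin n₁ → Fin n₂ → Fin m → Quaternion ℝ

namespace QTensor

/-- The frontal slice `T(:, :, t)`. -/
def frontalSlice {n₁ n₂ m : ℕ} (T : QTensor n₁ n₂ m) (t : Fin m) :
    Matrix (Fin n₁) (Fin n₂) (Quaternion ℝ) :=
  Matrix.of fun i j => T i j t

/-- The tensor with prescribed frontal slices. -/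
def ofFrontalSlices {n₁ n₂ m : ℕ} (A : Fin m → Matrix (Fin n₁) (Fin n₂) (Quaternion ℝ)) :
    QTensor n₁ n₂ m :=
  fun i j t => A t i j

/-- The block circulant matrix of `T`: an `m × m` array of `n₁ × n₂` blocks, whose block in block
row `s` and block column `t` is the frontal slice with index `s - t` modulo `m`. -/
def bcirc {n₁ n₂ m : ℕ} (T : QTensor n₁ n₂ m) :
    Matrix (Fin m × Fin n₁) (Fin m × Fin n₂) (Quaternion ℝ) :=
  Matrix.of fun p q => frontalSlice T (p.1 - q.1) p.2 q.2

/-- The block column matrix of the frontal slices of `T`. -/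
def unfold {n₁ n₂ m : ℕ} (T : QTensor n₁ n₂ m) :
    Matrix (Fin m × Fin n₁) (Fin n₂) (Quaternion ℝ) :=
  Matrix.of fun p j => frontalSlice T p.1 p.2 j

/-- The inverse of `unfold`: a block column matrix is turned back into a tensor. -/
def fold {n₁ n₂ m : ℕ} (M : Matrix (Fin m × Fin n₁) (Fin n₂) (Quaternion ℝ)) :
    QTensor n₁ n₂ m :=
  ofFrontalSlices fun t => Matrix.of fun i j => M (t, i) j

/-- The t-product `T ⋆ B = fold (bcirc T * unfold B)`. -/
noncomputable def tProd {n₁ n₂ n₃ m : ℕ} (T : QTensor n₁ n₂ m) (B : QTensor n₂ n₃ m) : QTensor n₁ n₃ m :=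
  fold (bcirc T * unfold B)

/-- The identity tensor: its first frontal slice is the identity matrix, the others vanish. -/
noncomputable def identity (n m : ℕ) [NeZero m] : QTensor n n m :=
  ofFrontalSlices fun t => if t = 0 then 1 else 0

/-- The conjugate transpose of a tensor: each frontal slice is conjugate transposed, the first
slice keeps its place and the order of the others is reversed (`t` and `m - t` are exchanged for
`0 < t < m`, which is negation modulo `m`). -/
noncomputable def conjTranspose {n₁ n₂ m : ℕ} [NeZero m] (T : QTensor n₁ n₂ m) : QTensor n₂ n₁ m :=
  ofFrontalSlices fun t => (frontalSlice T (-t)).conjTranspose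

/-- Unitary tensors: `Q* ⋆ Q = Q ⋆ Q* = I`. -/
def IsUnitary {n m : ℕ} [NeZero m] (Q : QTensor n n m) : Prop :=
  tProd (conjTranspose Q) Q = identity n m ∧ tProd Q (conjTranspose Q) = identity n m

/-- Diagonal tensors: every frontal slice is a (rectangular) diagonal matrix. -/
def IsDiagonal {n₁ n₂ m : ℕ} (S : QTensor n₁ n₂ m) : Prop :=
  ∀ (t : Fin m) (i : Fin n₁) (j : Fin n₂), (i : ℕ) ≠ (j : ℕ) → frontalSlice S t i j = 0

end QTensor

/-! The map `bcirc` turns the t-product and conjugate transpose into those of block circulant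
matrices, so it suffices to decompose a block circulant `M` by block circulant unitaries. No Fourier
transform or eigenvalue theory is used; the argument is variational. Let `D` be the `weight` matrix.
By compactness some pair `U`, `V` maximizes the real trace of `D * (Uᴴ * M * V)`. With `S = Uᴴ * M *
V`, varying `U` and `V` separately makes `S * D` and `D * S` Hermitian
(`isSelfAdjoint_of_trace_mul_unitary_le`). As the diagonal entries of `D` are positive and distinct,
every block of `S` is then diagonal (`apply_eq_zero_of_isHermitian_mul_weight`). -/

/-- In a finite-dimensional real star algebra with a faithful positive trace `τ`, if
`τ (N * W)` is maximal at `W = 1` among the unitary elements `W`, then `N` is self-adjoint. -/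
theorem isSelfAdjoint_of_trace_mul_unitary_le {A : Type*} [Ring A] [StarRing A] [Algebra ℝ A]
    [StarModule ℝ A] [FiniteDimensional ℝ A] (τ : A →ₗ[ℝ] ℝ)
    (τ_comm : ∀ a b, τ (a * b) = τ (b * a)) (τ_star : ∀ a, τ (star a) = τ a)
    (τ_nonneg : ∀ a, 0 ≤ τ (star a * a)) (τ_faithful : ∀ a, τ (star a * a) = 0 → a = 0)
    (N : A) (hN : ∀ W ∈ unitary A, τ (N * W) ≤ τ N) : IsSelfAdjoint N := by
  obtain ⟨X, hX⟩ : ∃ X, X = star N - N := ⟨_, rfl⟩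
  have hXs : star X = -X := by simp [hX]
  set Z := N * (X * X) with hZ
  set K := τ (Z * star Z) + τ 1 - 2 * τ Z with hK
  -- First-order variation along the skew direction `X`, with an error constant `K` independent of
  -- `t`.
  have key : ∀ t : ℝ, 4 * t * τ (N * X) ≤ t ^ 2 * K := by
    intro t
    set Y := t • X with hY
    have hYs : star Y = -Y := by simp [hY, hXs]
    have inj : ∀ a, (1 - Y) * a = 0 → a = 0 := by
      intro a ha
      apply τ_faithful
      have h1 : a = Y * a := by
        rw [sub_mul, one_mul, sub_eq_zero] at ha
        exact ha
      have h2 : τ (star a * (Y * a)) = -τ (star a * (Y * a)) := by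
        conv_lhs => rw [← τ_star]
        simp [hYs, mul_assoc]
      rw [← h1] at h2
      linarith
    -- Injective left multiplication is surjective in finite dimension, so the inverse stays in the
    -- algebra.
    obtain ⟨R, hR⟩ : ∃ R, (1 - Y) * R = 1 := by
      have hi : Function.Injective (LinearMap.mulLeft ℝ (1 - Y)) := by
        rw [← LinearMap.ker_eq_bot, LinearMap.ker_eq_bot']
        exact inj
      exact LinearMap.injective_iff_surjective.1 hi 1
    have hR' : R * (1 - Y) = 1 := by
      rw [← sub_eq_zero]
      apply inj
      rw [mul_sub, ← mul_assoc, hR, one_mul, mul_one, sub_self]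
    have hRs : star R * (1 + Y) = 1 := by
      have := congrArg star hR
      simpa [hYs] using this
    have hRs' : (1 + Y) * star R = 1 := by
      have := congrArg star hR'
      simpa [hYs] using this
    -- The Cayley transform `(1 + Y)(1 - Y)⁻¹`, unitary because `Y` is skew.
    set C := R + R - 1 with hC
    have e1 : star R * R + star R * R = star R + R := by
      calc star R * R + star R * R = star R * ((1 - Y) * R) + (star R * (1 + Y)) * R := by
            noncomm_ring
        _ = star R + R := by rw [hR, hRs]; simp
    have e2 : R * star R + R * star R = star R + R := by
      calc R * star R + R * star R = (R * (1 - Y)) * star R + R * ((1 + Y) * star R) := by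
            noncomm_ring
        _ = star R + R := by rw [hR', hRs']; simp
    have hC1 : star C * C = 1 := by
      calc star C * C = (star R * R + star R * R) + (star R * R + star R * R)
            - (star R + R) - (star R + R) + 1 := by
            simp only [hC, star_sub, star_add, star_one]; noncomm_ring
        _ = 1 := by rw [e1]; noncomm_ring
    have hC2 : C * star C = 1 := by
      calc C * star C = (R * star R + R * star R) + (R * star R + R * star R)
            - (star R + R) - (star R + R) + 1 := by
            simp only [hC, star_sub, star_add, star_one]; noncomm_ring
        _ = 1 := by rw [e2]; noncomm_ring
    have hle := hN C ⟨hC1, hC2⟩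
    have hR1 : R = 1 + Y * R := by
      rw [sub_mul, one_mul, sub_eq_iff_eq_add] at hR
      exact hR
    have hexp : C = 1 + (Y + Y) + Y * Y * (C + 1) := by
      have h2 : R = 1 + Y + Y * Y * R := by
        conv_lhs => rw [hR1, hR1]
        noncomm_ring
      calc C = R + R - 1 := rfl
        _ = (1 + Y + Y * Y * R) + (1 + Y + Y * Y * R) - 1 := by rw [← h2]
        _ = 1 + (Y + Y) + Y * Y * (C + 1) := by rw [hC]; noncomm_ring
    have hNC : τ (N * C) = τ N + 2 * t * τ (N * X) + t ^ 2 * (τ (Z * C) + τ Z) := by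
      have : N * C = N + (2 * t) • (N * X) + (t ^ 2) • (Z * C + Z) := by
        conv_lhs => rw [hexp]
        simp only [hY, hZ, mul_add, smul_mul_assoc, mul_smul_comm, smul_smul, mul_one, mul_assoc,
          two_mul, add_smul, smul_add, pow_two]
      rw [this]
      simp [mul_add]
    -- Positivity of `τ` on `star Z + C` bounds the remainder uniformly in `t`.
    have hlow : -(τ (Z * star Z) + τ 1) ≤ 2 * τ (Z * C) := by
      have h := τ_nonneg (star Z + C)
      have h3 : star (star Z + C) * (star Z + C)
          = Z * star Z + Z * C + star (Z * C) + star C * C := by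
        simp only [star_add, star_star, star_mul]; noncomm_ring
      rw [h3, hC1, map_add, map_add, map_add, τ_star] at h
      linarith
    have h5 := mul_le_mul_of_nonneg_left hlow (sq_nonneg t)
    rw [hNC] at hle
    rw [hK]
    nlinarith
  have hzero : τ (N * X) = 0 := by
    by_contra h0
    have hpos : 0 < τ (N * X) ^ 2 := by positivity
    have hK0 : 0 < |K| + 1 := by positivity
    -- At this small `t` the linear term beats the quadratic one.
    have h := key (τ (N * X) / (|K| + 1))
    have h6 : (τ (N * X) / (|K| + 1)) ^ 2 * K ≤ τ (N * X) ^ 2 / (|K| + 1) := by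
      rw [div_pow, div_mul_eq_mul_div, div_le_div_iff₀ (by positivity) hK0]
      have : K * (|K| + 1) ≤ (|K| + 1) ^ 2 := by nlinarith [le_abs_self K, abs_nonneg K]
      nlinarith
    have h7 : 4 * (τ (N * X) / (|K| + 1)) * τ (N * X) = 4 * (τ (N * X) ^ 2 / (|K| + 1)) := by ring
    have h8 : 0 < τ (N * X) ^ 2 / (|K| + 1) := by positivity
    linarith
  have hXX : τ (star X * X) = 0 := by
    have h1 : τ (star N * X) = -τ (N * X) := by
      rw [← τ_star, star_mul, star_star, hXs, neg_mul, map_neg, τ_comm]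
    rw [hXs, neg_mul, map_neg]
    conv_lhs => rw [hX, sub_mul, map_sub, ← hX]
    rw [h1, hzero]
    simp
  have := τ_faithful X hXX
  rw [hX, sub_eq_zero] at this
  exact this

/-! ### The real trace on quaternion matrices -/

namespace QTensor

open Matrix Quaternion

/-- The real part of the trace of a square quaternion matrix. -/
noncomputable def reTrace (ι : Type*) [Fintype ι] : Matrix ι ι ℍ[ℝ] →ₗ[ℝ] ℝ where
  toFun M := ∑ p, (M p p).re
  map_add' M N := by simp [Finset.sum_add_distrib]
  map_smul' c M := by simp [Finset.mul_sum]

theorem re_sum {ι : Type*} (s : Finset ι) (f : ι → ℍ[ℝ]) :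
    (∑ x ∈ s, f x).re = ∑ x ∈ s, (f x).re :=
  map_sum (QuaternionAlgebra.reₗ (-1 : ℝ) 0 (-1)) f s

instance : StarModule ℝ ℍ[ℝ] := ⟨fun r a => by rw [Quaternion.star_smul, star_trivial r]⟩

theorem reTrace_apply {ι : Type*} [Fintype ι] (M : Matrix ι ι ℍ[ℝ]) :
    reTrace ι M = ∑ p, (M p p).re := rfl

/-- Quaternions do not commute, but the real part of a product of two is symmetric; hence the real
part in `reTrace`. -/
theorem reTrace_mul_comm {ι κ : Type*} [Fintype ι] [Fintype κ] (M : Matrix ι κ ℍ[ℝ])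
    (N : Matrix κ ι ℍ[ℝ]) : reTrace ι (M * N) = reTrace κ (N * M) := by
  simp only [reTrace_apply, Matrix.mul_apply, re_sum]
  rw [Finset.sum_comm]
  refine Finset.sum_congr rfl fun q _ => Finset.sum_congr rfl fun p _ => ?_
  simp only [Quaternion.re_mul]
  ring

theorem reTrace_conjTranspose {ι : Type*} [Fintype ι] (M : Matrix ι ι ℍ[ℝ]) :
    reTrace ι Mᴴ = reTrace ι M := by
  simp [reTrace_apply]

theorem re_conjTranspose_mul_self_apply {ι κ : Type*} [Fintype ι]
    (M : Matrix ι κ ℍ[ℝ]) (q : κ) : ((Mᴴ * M) q q).re = ∑ p, ‖M p q‖ ^ 2 := by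
  rw [Matrix.mul_apply, re_sum]
  refine Finset.sum_congr rfl fun p _ => ?_
  rw [conjTranspose_apply, Quaternion.star_mul_self, Quaternion.normSq_eq_norm_mul_self, sq]
  rfl

theorem reTrace_conjTranspose_mul_self_nonneg {ι : Type*} [Fintype ι] (M : Matrix ι ι ℍ[ℝ]) :
    0 ≤ reTrace ι (Mᴴ * M) := by
  simp only [reTrace_apply, re_conjTranspose_mul_self_apply]
  positivity

theorem eq_zero_of_reTrace_conjTranspose_mul_self {ι : Type*} [Fintype ι] (M : Matrix ι ι ℍ[ℝ])
    (h : reTrace ι (Mᴴ * M) = 0) : M = 0 := by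
  simp only [reTrace_apply, re_conjTranspose_mul_self_apply] at h
  ext1 p q
  rw [Finset.sum_eq_zero_iff_of_nonneg fun _ _ => by positivity] at h
  have h1 := h q (Finset.mem_univ q)
  rw [Finset.sum_eq_zero_iff_of_nonneg fun _ _ => by positivity] at h1
  simpa using h1 p (Finset.mem_univ p)

/-! ### Block circulant matrices and the weight -/

/-- Invariance of a block matrix under simultaneous cyclic shifts of block rows and columns. -/
def IsBlockCirculant {n₁ n₂ m : ℕ} (M : Matrix (Fin m × Fin n₁) (Fin m × Fin n₂) ℍ[ℝ]) : Prop :=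
  ∀ c s t i j, M (s + c, i) (t + c, j) = M (s, i) (t, j)

variable {n n₁ n₂ n₃ m : ℕ}

theorem IsBlockCirculant.conjTranspose {M : Matrix (Fin m × Fin n₁) (Fin m × Fin n₂) ℍ[ℝ]}
    (hM : IsBlockCirculant M) : IsBlockCirculant Mᴴ := by
  intro c s t i j
  simp only [conjTranspose_apply, hM c]

theorem isBlockCirculant_algebraMap (r : ℝ) : IsBlockCirculant
    (algebraMap ℝ (Matrix (Fin m × Fin n) (Fin m × Fin n) ℍ[ℝ]) r) := by
  intro c s t i j
  simp [Matrix.algebraMap_matrix_apply]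

variable (n₁ n₂ m) in
/-- The block circulant matrix of the rectangular diagonal tensor whose first frontal slice has
diagonal `1, 2, 3, …`, the other frontal slices being zero. -/
noncomputable def weight : Matrix (Fin m × Fin n₁) (Fin m × Fin n₂) ℍ[ℝ] :=
  Matrix.of fun p q => if p.1 = q.1 ∧ (p.2 : ℕ) = q.2 then (((p.2 : ℝ) + 1 : ℝ) : ℍ[ℝ]) else 0

theorem mul_weight_apply (M : Matrix (Fin m × Fin n₁) (Fin m × Fin n₂) ℍ[ℝ])
    (p q : Fin m × Fin n₁) : (M * weight n₂ n₁ m) p q =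
      if h : (q.2 : ℕ) < n₂ then ((q.2 : ℝ) + 1) • M p (q.1, ⟨q.2, h⟩) else 0 := by
  rw [Matrix.mul_apply]
  split_ifs with h
  · rw [Finset.sum_eq_single (q.1, ⟨q.2, h⟩)]
    · simp [weight, Quaternion.mul_coe_eq_smul, -Quaternion.coe_add]
    · rintro ⟨r, k⟩ - hne
      have : ¬ (r = q.1 ∧ (k : ℕ) = q.2) := fun hk =>
        hne (Prod.ext hk.1 (Fin.ext hk.2))
      simp [weight, this]
    · simp
  · refine Finset.sum_eq_zero fun r _ => ?_
    have : ¬ (r.1 = q.1 ∧ (r.2 : ℕ) = q.2) := fun hk => h (hk.2 ▸ r.2.2)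
    simp [weight, this]

theorem weight_mul_apply (M : Matrix (Fin m × Fin n₁) (Fin m × Fin n₂) ℍ[ℝ])
    (p q : Fin m × Fin n₂) : (weight n₂ n₁ m * M) p q =
      if h : (p.2 : ℕ) < n₁ then ((p.2 : ℝ) + 1) • M (p.1, ⟨p.2, h⟩) q else 0 := by
  rw [Matrix.mul_apply]
  split_ifs with h
  · rw [Finset.sum_eq_single (p.1, ⟨p.2, h⟩)]
    · simp [weight, Quaternion.coe_mul_eq_smul, -Quaternion.coe_add]
    · rintro ⟨r, k⟩ - hne
      have : ¬ (p.1 = r ∧ (p.2 : ℕ) = k) := fun hk =>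
        hne (Prod.ext hk.1.symm (Fin.ext hk.2.symm))
      simp [weight, this]
    · simp
  · refine Finset.sum_eq_zero fun r _ => ?_
    have : ¬ (p.1 = r.1 ∧ (p.2 : ℕ) = r.2) := fun hk => h (hk.2 ▸ r.2.2)
    simp [weight, this]

/-- The two conditions link entry `(i, j)` to its mirror entry `(j, i)` with the weights `i + 1` and
`j + 1` interchanged. Eliminating the mirror entry leaves the factor `(i + 1)² - (j + 1)²`, nonzero
for `i ≠ j`. If the mirror entry lies outside the rectangle, one condition suffices. -/
theorem apply_eq_zero_of_isHermitian_mul_weight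
    {M : Matrix (Fin m × Fin n₁) (Fin m × Fin n₂) ℍ[ℝ]}
    (h₁ : (M * weight n₂ n₁ m).IsHermitian) (h₂ : (weight n₂ n₁ m * M).IsHermitian)
    (s t : Fin m) (i : Fin n₁) (j : Fin n₂) (hij : (i : ℕ) ≠ j) : M (s, i) (t, j) = 0 := by
  have pos : ∀ k : ℕ, (k : ℝ) + 1 ≠ 0 := fun k => by positivity
  by_cases hj : (j : ℕ) < n₁
  · have e₁ := h₁.apply (s, i) (t, ⟨j, hj⟩)
    rw [mul_weight_apply, mul_weight_apply, dif_pos j.2] at e₁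
    by_cases hi : (i : ℕ) < n₂
    · have e₂ := h₂.apply (s, ⟨i, hi⟩) (t, j)
      rw [weight_mul_apply, weight_mul_apply, dif_pos i.2, dif_pos hj] at e₂
      rw [dif_pos hi] at e₁
      simp only [Quaternion.star_smul] at e₁ e₂
      have e₃ : (((i : ℝ) + 1) * ((i : ℝ) + 1)) • M (s, i) (t, j)
          = (((j : ℝ) + 1) * ((j : ℝ) + 1)) • M (s, i) (t, j) := by
        rw [mul_smul, mul_smul]
        rw [show _ • M (s, i) (t, j) = _ from e₂.symm, show _ • M (s, i) (t, j) = _ from e₁.symm,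
          smul_comm]
      rw [← sub_eq_zero, ← sub_smul, smul_eq_zero] at e₃
      refine e₃.resolve_left fun h0 => hij ?_
      have h1 : ((i : ℝ) - j) * ((i : ℝ) + j + 2) = 0 := by linarith
      have h2 : (i : ℝ) + j + 2 ≠ 0 := by positivity
      exact_mod_cast sub_eq_zero.1 ((mul_eq_zero.1 h1).resolve_right h2)
    · rw [dif_neg hi, star_zero, eq_comm, smul_eq_zero] at e₁
      exact e₁.resolve_left (pos _)
  · have hi : (i : ℕ) < n₂ := by omega
    have e₂ := h₂.apply (s, ⟨i, hi⟩) (t, j)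
    rw [weight_mul_apply, weight_mul_apply, dif_pos i.2, dif_neg hj, star_zero, eq_comm,
      smul_eq_zero] at e₂
    exact e₂.resolve_left (pos _)

theorem isBlockCirculant_weight : IsBlockCirculant (weight n₁ n₂ m) := by
  intro c s t i j
  simp [weight]

variable (n m) in
theorem isCompact_unitary_blockCirculant :
    IsCompact {U : Matrix (Fin m × Fin n) (Fin m × Fin n) ℍ[ℝ] |
      IsBlockCirculant U ∧ U ∈ unitary (Matrix (Fin m × Fin n) (Fin m × Fin n) ℍ[ℝ])} := by
  have : ProperSpace ℍ[ℝ] := FiniteDimensional.proper ℝ ℍ[ℝ]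
  refine IsCompact.of_isClosed_subset
    (isCompact_univ_pi fun _ => isCompact_univ_pi fun _ => isCompact_closedBall (0 : ℍ[ℝ]) 1)
    (IsClosed.inter ?_ ?_) ?_
  · change IsClosed {U | IsBlockCirculant U}
    simp only [IsBlockCirculant, Set.ofPred_forall]
    refine isClosed_iInter fun c => isClosed_iInter fun s => isClosed_iInter fun t =>
      isClosed_iInter fun i => isClosed_iInter fun j => isClosed_eq ?_ ?_
    · exact continuous_id.matrix_elem _ _
    · exact continuous_id.matrix_elem _ _
  · refine IsClosed.inter (isClosed_eq ?_ continuous_const) (isClosed_eq ?_ continuous_const)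
    · exact continuous_id.matrix_conjTranspose.matrix_mul continuous_id
    · exact continuous_id.matrix_mul continuous_id.matrix_conjTranspose
  · rintro U ⟨-, hU, -⟩ p - q -
    have h := re_conjTranspose_mul_self_apply U q
    have hU' : Uᴴ * U = 1 := hU
    rw [hU', Matrix.one_apply_eq, Quaternion.re_one] at h
    have h1 : ‖U p q‖ ^ 2 ≤ 1 := h ▸ Finset.single_le_sum
      (f := fun p => ‖U p q‖ ^ 2) (fun _ _ => by positivity) (Finset.mem_univ p)
    rw [mem_closedBall_zero_iff]
    exact (sq_le_one_iff₀ (norm_nonneg _)).1 h1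

/-! ### The t-product as multiplication of block circulant matrices -/

variable [NeZero m]

theorem IsBlockCirculant.mul {M : Matrix (Fin m × Fin n₁) (Fin m × Fin n₂) ℍ[ℝ]}
    {N : Matrix (Fin m × Fin n₂) (Fin m × Fin n₃) ℍ[ℝ]} (hM : IsBlockCirculant M)
    (hN : IsBlockCirculant N) : IsBlockCirculant (M * N) := by
  intro c s t i j
  simp only [Matrix.mul_apply, Fintype.sum_prod_type]
  rw [← Equiv.sum_comp (Equiv.addRight c)]
  simp only [Equiv.coe_addRight, hM c, hN c]

theorem isBlockCirculant_bcirc (T : QTensor n₁ n₂ m) : IsBlockCirculant (bcirc T) := by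
  intro c s t i j
  simp [bcirc]

variable (n m) in
/-- The star algebra of square block circulant quaternion matrices. -/
def blockCirculant : StarSubalgebra ℝ (Matrix (Fin m × Fin n) (Fin m × Fin n) ℍ[ℝ]) where
  carrier := {M | IsBlockCirculant M}
  mul_mem' hM hN := hM.mul hN
  add_mem' hM hN c s t i j := by simp only [Matrix.add_apply, hM c, hN c]
  algebraMap_mem' := isBlockCirculant_algebraMap
  star_mem' hM := hM.conjTranspose

theorem isHermitian_of_reTrace_mul_le
    {N : Matrix (Fin m × Fin n) (Fin m × Fin n) ℍ[ℝ]} (hN : IsBlockCirculant N)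
    (h : ∀ W, IsBlockCirculant W → W ∈ unitary (Matrix (Fin m × Fin n) (Fin m × Fin n) ℍ[ℝ]) →
      reTrace _ (N * W) ≤ reTrace _ N) : N.IsHermitian := by
  have : FiniteDimensional ℝ (blockCirculant n m) :=
    FiniteDimensional.finiteDimensional_submodule (blockCirculant n m).toSubalgebra.toSubmodule
  have key := isSelfAdjoint_of_trace_mul_unitary_le (A := blockCirculant n m)
    ((reTrace _).comp (blockCirculant n m).toSubalgebra.val.toLinearMap)
    (fun a b => reTrace_mul_comm a.1 b.1) (fun a => reTrace_conjTranspose a.1)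
    (fun a => reTrace_conjTranspose_mul_self_nonneg a.1)
    (fun a ha => Subtype.ext (eq_zero_of_reTrace_conjTranspose_mul_self a.1 ha))
    ⟨N, hN⟩ (fun W hW => h W.1 W.2
      ⟨congrArg Subtype.val hW.1, congrArg Subtype.val hW.2⟩)
  exact congrArg Subtype.val key

theorem bcirc_tProd (T : QTensor n₁ n₂ m) (B : QTensor n₂ n₃ m) :
    bcirc (tProd T B) = bcirc T * bcirc B := by
  ext1 ⟨s, i⟩ ⟨t, j⟩
  simp only [bcirc, tProd, fold, unfold, ofFrontalSlices, frontalSlice, Matrix.mul_apply,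
    Matrix.of_apply, Fintype.sum_prod_type]
  rw [← Equiv.sum_comp (Equiv.subRight t)]
  simp only [Equiv.subRight_apply, sub_sub_sub_cancel_right]

theorem bcirc_conjTranspose (T : QTensor n₁ n₂ m) : bcirc (conjTranspose T) = (bcirc T)ᴴ := by
  ext1 ⟨s, i⟩ ⟨t, j⟩
  simp [bcirc, conjTranspose, ofFrontalSlices, frontalSlice]

theorem bcirc_identity : bcirc (identity n m) = 1 := by
  ext1 ⟨s, i⟩ ⟨t, j⟩
  by_cases h : s = t
  · simp [bcirc, identity, ofFrontalSlices, frontalSlice, h, Matrix.one_apply]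
  · simp [bcirc, identity, ofFrontalSlices, frontalSlice, h, sub_eq_zero]

theorem bcirc_injective : Function.Injective (bcirc : QTensor n₁ n₂ m → _) := by
  intro T B h
  funext i j t
  simpa [bcirc, frontalSlice] using congrFun (congrFun h (t, i)) (0, j)

theorem IsBlockCirculant.exists_bcirc_eq {M : Matrix (Fin m × Fin n₁) (Fin m × Fin n₂) ℍ[ℝ]}
    (hM : IsBlockCirculant M) : ∃ T : QTensor n₁ n₂ m, bcirc T = M := by
  refine ⟨fun i j t => M (t, i) (0, j), ?_⟩
  ext1 ⟨s, i⟩ ⟨t, j⟩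
  simpa [bcirc, frontalSlice] using (hM t (s - t) 0 i j).symm

theorem isUnitary_iff {U : QTensor n n m} :
    IsUnitary U ↔ bcirc U ∈ unitary (Matrix (Fin m × Fin n) (Fin m × Fin n) ℍ[ℝ]) := by
  rw [IsUnitary, ← bcirc_injective.eq_iff, ← bcirc_injective.eq_iff, bcirc_tProd, bcirc_tProd,
    bcirc_conjTranspose, bcirc_identity, Unitary.mem_iff]
  rfl

/-- Singular value decomposition within block circulant quaternion matrices. -/
theorem IsBlockCirculant.exists_svd {M : Matrix (Fin m × Fin n₁) (Fin m × Fin n₂) ℍ[ℝ]}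
    (hM : IsBlockCirculant M) :
    ∃ (U : Matrix (Fin m × Fin n₁) (Fin m × Fin n₁) ℍ[ℝ])
      (V : Matrix (Fin m × Fin n₂) (Fin m × Fin n₂) ℍ[ℝ]),
      (IsBlockCirculant U ∧ U ∈ unitary _) ∧ (IsBlockCirculant V ∧ V ∈ unitary _) ∧
        ∀ (s t : Fin m) (i : Fin n₁) (j : Fin n₂), (i : ℕ) ≠ (j : ℕ) → (Uᴴ * M * V) (s, i) (t, j) = 0 := by
  have one_mem (k : ℕ) : IsBlockCirculant (1 : Matrix (Fin m × Fin k) (Fin m × Fin k) ℍ[ℝ]) ∧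
      (1 : Matrix (Fin m × Fin k) (Fin m × Fin k) ℍ[ℝ]) ∈ unitary _ :=
    ⟨(blockCirculant k m).one_mem, one_mem _⟩
  have re_cont : Continuous (reTrace (Fin m × Fin n₂)) :=
    LinearMap.continuous_of_finiteDimensional _
  obtain ⟨⟨U, V⟩, ⟨hU, hV⟩, hmax⟩ :=
    ((isCompact_unitary_blockCirculant n₁ m).prod
      (isCompact_unitary_blockCirculant n₂ m)).exists_isMaxOn
      ⟨(1, 1), one_mem _, one_mem _⟩
      (f := fun P => reTrace _ (weight n₂ n₁ m * (P.1ᴴ * M * P.2)))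
      (re_cont.comp (continuous_const.matrix_mul
        ((continuous_fst.matrix_conjTranspose.matrix_mul continuous_const).matrix_mul
          continuous_snd))).continuousOn
  have hS : IsBlockCirculant (Uᴴ * M * V) := (hU.1.conjTranspose.mul hM).mul hV.1
  refine ⟨U, V, hU, hV, apply_eq_zero_of_isHermitian_mul_weight ?_ ?_⟩
  -- Replacing `U` by `U * Wᴴ` turns `S` into `W * S`; cyclicity of the trace moves `W` to the right
  -- of `S * D`.
  · refine isHermitian_of_reTrace_mul_le (hS.mul isBlockCirculant_weight) fun W hW hWu => ?_
    have h := hmax (Set.mk_mem_prod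
      (⟨hU.1.mul hW.conjTranspose, mul_mem hU.2 (Unitary.star_mem hWu)⟩ : _ ∧ _) hV)
    simp only [Set.mem_ofPred_eq, conjTranspose_mul, conjTranspose_conjTranspose] at h
    rw [reTrace_mul_comm (Uᴴ * M * V), Matrix.mul_assoc (Uᴴ * M * V), reTrace_mul_comm]
    rw [Matrix.mul_assoc, ← Matrix.mul_assoc W, ← Matrix.mul_assoc W]
    simpa only [Matrix.mul_assoc] using h
  -- Replacing `V` by `V * W` turns `D * S` into `D * S * W`.
  · refine isHermitian_of_reTrace_mul_le (isBlockCirculant_weight.mul hS) fun W hW hWu => ?_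
    have h := hmax (Set.mk_mem_prod hU (⟨hV.1.mul hW, mul_mem hV.2 hWu⟩ : _ ∧ _))
    simpa only [Set.mem_ofPred_eq, Matrix.mul_assoc] using h

end QTensor

theorem theorem3 (n₁ n₂ m : ℕ) [NeZero m] (T : QTensor n₁ n₂ m) :
    ∃ (U : QTensor n₁ n₁ m) (S : QTensor n₁ n₂ m) (V : QTensor n₂ n₂ m),
      QTensor.IsUnitary U ∧ QTensor.IsUnitary V ∧ QTensor.IsDiagonal S ∧
        T = QTensor.tProd (QTensor.tProd U S) (QTensor.conjTranspose V) := by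
  have hT := QTensor.isBlockCirculant_bcirc T
  obtain ⟨U', V', ⟨hU, hUu⟩, ⟨hV, hVu⟩, hS⟩ := hT.exists_svd
  obtain ⟨S, hSe⟩ := ((hU.conjTranspose.mul hT).mul hV).exists_bcirc_eq
  obtain ⟨U, rfl⟩ := hU.exists_bcirc_eq
  obtain ⟨V, rfl⟩ := hV.exists_bcirc_eq
  refine ⟨U, S, V, QTensor.isUnitary_iff.2 hUu, QTensor.isUnitary_iff.2 hVu, ?_, ?_⟩
  · intro t i j hij
    -- Block column `0` lists the frontal slices.
    have h := hS t 0 i j hij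
    rw [← hSe] at h
    simpa [QTensor.bcirc] using h
  · apply QTensor.bcirc_injective
    rw [QTensor.bcirc_tProd, QTensor.bcirc_tProd, QTensor.bcirc_conjTranspose, hSe]
    have e₁ : QTensor.bcirc U * (QTensor.bcirc U).conjTranspose = 1 := hUu.2
    have e₂ : QTensor.bcirc V * (QTensor.bcirc V).conjTranspose = 1 := hVu.2
    rw [Matrix.mul_assoc, Matrix.mul_assoc (_ * _), e₂, Matrix.mul_one, ← Matrix.mul_assoc, e₁,
      Matrix.one_mul]
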